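/- For integers $k\ge 1$, $\Delta\ge 1$, let $n^*(k,\Delta)$ be the smallest integer $n\ge 0$ for which there is a (possibly randomized) integer-valued estimator $\hat C$, a function of the colors of $n$ balls drawn independently and uniformly with replacement from an urn, such that $\mathbb P[|\hat C-C|\ge\Delta]\le 0.1$ for every urn containing $k$ colored balls, where $C$ denotes the number of distinct colors in the urn. **Theorem.** There are absolute constants $c,c',c_1,c_2>0$ such that the following hold for all integers $k,\Delta$. 1. If $1\le\Delta\le k/2$, then $$n^*(k,\Delta)\ \ge\ c\,\frac{k-2\Delta}{\sqrt k}.$$ 2. If $1\le\Delta<k/4$, then $$n^*(k,\Delta)\ \ge\ c'\,k\,\operatorname{arccosh}\Bigl(1+\frac{k}{4\Delta^2}\Bigr).$$ 3. If $1\le\Delta<k/4$, then the right-hand side of part 2 is of the following order: $$c_1\,k\log\Bigl(1+\frac{k}{\Delta^2}\Bigr)\ \le\ k\operatorname{arccosh}\Bigl(1+\frac{k}{4\Delta^2}\Bigr)\ \le\ c_2\,k\log\Bigl(1+\frac{k}{\Delta^2}\Bigr)\quad\text{if }\Delta\le\sqrt k,$$ $$c_1\,\frac{k^{3/2}}{\Delta}\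 \le\ k\operatorname{arccosh}\Bigl(1+\frac{k}{4\Delta^2}\Bigr)\ \le\ c_2\,\frac{k^{3/2}}{\Delta}\quad\text{if }\Delta\ge\sqrt k.$$ -/

import Mathlib

namespace DistinctElements

/-- An urn with `k` coloured balls: the balls are the elements of `Fin k`, and `u b` is the colour
(a natural number used as a label) of the ball `b`. -/
abbrev Urn (k : ℕ) : Type := Fin k → ℕ

/-- The number `C` of different colours in the urn. -/
def Urn.numColors {k : ℕ} (u : Urn k) : ℕ := (Finset.univ.image u).card

/-- The law of the observed colours `(X₁, …, Xₙ)` of `n` balls drawn independently and uniformly with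
replacement from the urn: all `kⁿ` sequences of balls are equally likely. -/
noncomputable def Urn.sampleLaw {k : ℕ} [NeZero k] (u : Urn k) (n : ℕ) : PMF (Fin n → ℕ) :=
  (PMF.uniformOfFintype (Fin n → Fin k)).map (fun s i => u (s i))

/-- A (possibly randomized) integer-valued estimator based on the colours of `n` balls. Deterministic
estimators are the ones whose values are Dirac masses `PMF.pure z`. -/
abbrev Estimator (n : ℕ) : Type := (Fin n → ℕ) → PMF ℤ

/-- The probability `P[|Ĉ - C| ≥ Δ]` of the estimator `Ĉ` applied to `n` balls drawn from `u`. -/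
noncomputable def errorProb {k : ℕ} [NeZero k] {n : ℕ} (Chat : Estimator n) (u : Urn k) (Δ : ℕ) : ℝ :=
  (((u.sampleLaw n).bind Chat).toOuterMeasure
    {z : ℤ | (Δ : ℤ) ≤ |z - (u.numColors : ℤ)|}).toReal

/-- `n` samples suffice: some estimator based on `n` balls has, for every urn with `k` balls,
an error of at least `Δ` with probability at most `0.1`. -/
def Suffices (k : ℕ) [NeZero k] (Δ n : ℕ) : Prop :=
  ∃ Chat : Estimator n, ∀ u : Urn k, errorProb Chat u Δ ≤ 0.1

/-- The sample complexity `n*(k, Δ)`: the minimal sufficient sample size. -/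
noncomputable def sampleComplexity (k : ℕ) [NeZero k] (Δ : ℕ) : ℕ :=
  sInf {n : ℕ | Suffices k Δ n}

/-- For `Δ ≥ 1` some sample size suffices, so that the minimum above is attained. -/
theorem exists_suffices (k : ℕ) [NeZero k] {Δ : ℕ} (hΔ : 1 ≤ Δ) : ∃ n : ℕ, Suffices k Δ n := by
  classical
  have hk : 0 < k := Nat.pos_of_ne_zero (NeZero.ne k)
  have hk' : (0 : ℝ) < k := by exact_mod_cast hk
  have hlim : Filter.Tendsto (fun n : ℕ => (k : ℝ) * (((k - 1 : ℕ) : ℝ) / k) ^ n)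
      Filter.atTop (nhds ((k : ℝ) * 0)) := by
    refine (tendsto_pow_atTop_nhds_zero_of_lt_one (by positivity) ?_).const_mul _
    rw [div_lt_one hk']
    exact_mod_cast Nat.sub_lt hk one_pos
  rw [mul_zero] at hlim
  obtain ⟨n, hn⟩ := (hlim.eventually (gt_mem_nhds (show (0 : ℝ) < 0.1 by norm_num))).exists
  refine ⟨n, fun x => PMF.pure ((Finset.univ.image x).card : ℤ), fun u => ?_⟩
  -- the samples for which the number of observed colours is wrong miss some ball
  set B : Finset (Fin n → Fin k) :=
    Finset.univ.biUnion fun i : Fin k => Fintype.piFinset fun _ : Fin n => Finset.univ.erase i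
    with hB
  have hcard : B.card ≤ k * (k - 1) ^ n := by
    refine Finset.card_biUnion_le.trans (le_of_eq ?_)
    simp
  have hbad : ∀ s : Fin n → Fin k, s ∉ B →
      (Finset.univ.image fun i => u (s i)).card = u.numColors := by
    intro s hs
    unfold Urn.numColors
    congr 1
    ext c
    simp only [hB, Finset.mem_biUnion, Fintype.mem_piFinset, Finset.mem_erase, Finset.mem_univ,
      true_and, and_true, not_exists, not_forall, not_not] at hs
    simp only [Finset.mem_image, Finset.mem_univ, true_and]
    constructor
    · rintro ⟨i, rfl⟩
      exact ⟨_, rfl⟩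
    · rintro ⟨b, rfl⟩
      obtain ⟨i, hi⟩ := hs b
      exact ⟨i, by rw [hi]⟩
  have hle : ((u.sampleLaw n).bind fun x => PMF.pure ((Finset.univ.image x).card : ℤ)).toOuterMeasure
      {z : ℤ | (Δ : ℤ) ≤ |z - (u.numColors : ℤ)|}
      ≤ (PMF.uniformOfFintype (Fin n → Fin k)).toOuterMeasure (B : Set (Fin n → Fin k)) := by
    change ((u.sampleLaw n).bind (PMF.pure ∘ fun x => ((Finset.univ.image x).card : ℤ))).toOuterMeasure
      _ ≤ _
    rw [PMF.bind_pure_comp, Urn.sampleLaw, PMF.map_comp, PMF.toOuterMeasure_map_apply]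
    apply MeasureTheory.OuterMeasure.mono
    intro s hs
    by_contra hsB
    have := hbad s (by simpa using hsB)
    simp only [Set.mem_preimage, Function.comp_apply, Set.mem_ofPred_eq, this, sub_self,
      abs_zero] at hs
    omega
  have hval : ((PMF.uniformOfFintype (Fin n → Fin k)).toOuterMeasure
      (B : Set (Fin n → Fin k))).toReal = (B.card : ℝ) / (k : ℝ) ^ n := by
    rw [PMF.toOuterMeasure_uniformOfFintype_apply]
    simp
  have hne : (PMF.uniformOfFintype (Fin n → Fin k)).toOuterMeasure
      (B : Set (Fin n → Fin k)) ≠ ⊤ := by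
    rw [PMF.toOuterMeasure_uniformOfFintype_apply]
    exact ENNReal.div_ne_top (by simp) (by simp [hk.ne'])
  refine (ENNReal.toReal_mono hne hle).trans ?_
  rw [hval]
  have h2 : (B.card : ℝ) ≤ (k : ℝ) * ((k - 1 : ℕ) : ℝ) ^ n := by exact_mod_cast hcard
  calc (B.card : ℝ) / (k : ℝ) ^ n ≤ (k : ℝ) * ((k - 1 : ℕ) : ℝ) ^ n / (k : ℝ) ^ n := by gcongr
    _ = (k : ℝ) * (((k - 1 : ℕ) : ℝ) / k) ^ n := by rw [div_pow]; ring
    _ ≤ 0.1 := hn.le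

end DistinctElements

/-! ### Symmetrization of estimators over relabellings of the colours. -/

namespace DistinctElements

open Finset

/-! All lower bounds come from urns that few draws cannot tell apart. Averaging over relabellings of
the colours, one may assume that the estimator sees only which draws have equal colours
(`Suffices.exists_invariantEstimator`).

The square-root bound is a birthday argument (`InvariantEstimator.le_four_mul_sq`). With k = m + 2Δ,
an urn with k colours and one with m almost equally frequent colours look alike until a colour
repeats, which takes about √m draws, while no answer is acceptable for both. Hence k - 2Δ ≤ 4n².

For the arcosh bound, group the balls into pairs and the pairs into B blocks of size t, and merge
the colours within every pair of a uniformly random set of blocks. The status of a block is visible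
only once both balls of one of its pairs are drawn. Given R unrevealed blocks, the colour count
still contains t times a Binomial(R, 1/2) variable, so when R is at least a multiple of (Δ/t + 1)²,
every guess misses by Δ or more with probability at least 1/2. A sufficient n must therefore rarely
leave that many blocks unrevealed (`InvariantEstimator.card_unrevealed_le`).

If k is at most of order Δ², take t of order Δ²/k + 1: revealing about half of the blocks needs n²
of order kB, that is k³/Δ² (`InvariantEstimator.pow_three_le`). If k is much larger than Δ², take t
= 1: by coupon collecting, about (k/2)(1 - 2/k)^n pairs are untouched, which forces n of order k
log(k/Δ²) (`InvariantEstimator.log_lt`). When Δ is comparable to k, the birthday bound suffices.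
Elementary estimates compare arcosh with these expressions. -/

theorem one_sub_le_toReal_sum {P : PMF ℤ} {S : Set ℤ} {I : Finset ℤ} (h : ∀ z, z ∈ S ∨ z ∈ I) :
    1 - (P.toOuterMeasure S).toReal ≤ ∑ z ∈ I, (P z).toReal := by
  have h1 : (1 : ENNReal) ≤ P.toOuterMeasure S + P.toOuterMeasure I := by
    calc (1 : ENNReal) = P.toOuterMeasure (S ∪ I) := by
          symm
          rw [PMF.toOuterMeasure_apply_eq_one_iff]
          intro z _
          simpa using h z
      _ ≤ _ := MeasureTheory.measure_union_le _ _
  have hne : ∀ T : Set ℤ, P.toOuterMeasure T ≠ ⊤ := fun T =>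
    ne_top_of_le_ne_top ENNReal.one_ne_top (by
      calc P.toOuterMeasure T ≤ P.toOuterMeasure Set.univ :=
            MeasureTheory.OuterMeasure.mono _ (Set.subset_univ _)
        _ = 1 := (PMF.toOuterMeasure_apply_eq_one_iff _ _).2 (Set.subset_univ _))
  have h2 := ENNReal.toReal_mono (ENNReal.add_ne_top.2 ⟨hne S, hne I⟩) h1
  rw [ENNReal.toReal_add (hne S) (hne I), PMF.toOuterMeasure_apply_finset,
    ENNReal.toReal_sum (fun z _ => PMF.apply_ne_top P z)] at h2
  simp only [ENNReal.toReal_one] at h2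
  linarith

theorem toReal_sum_le_one (P : PMF ℤ) (I : Finset ℤ) : ∑ z ∈ I, (P z).toReal ≤ 1 := by
  rw [← ENNReal.toReal_sum (fun z _ => PMF.apply_ne_top P z)]
  refine ENNReal.toReal_le_of_le_ofReal zero_le_one ?_
  rw [ENNReal.ofReal_one, ← P.tsum_coe]
  exact ENNReal.sum_le_tsum I

/-- An estimator with error probability at most `0.1` succeeds with probability at least `0.9`,
written as a sum over the sequences of drawn balls. -/
theorem success_of_errorProb_le {k : ℕ} [NeZero k] {n Δ : ℕ} {Chat : Estimator n} {u : Urn k}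
    (h : errorProb Chat u Δ ≤ 0.1) :
    0.9 * (k : ℝ) ^ n ≤ ∑ s : Fin n → Fin k,
      ∑ z ∈ Ioo ((u.numColors : ℤ) - Δ) (u.numColors + Δ), (Chat (fun i => u (s i)) z).toReal := by
  have hk : 0 < (k : ℝ) := by exact_mod_cast Nat.pos_of_ne_zero (NeZero.ne k)
  have h1 := one_sub_le_toReal_sum (P := (u.sampleLaw n).bind Chat)
    (S := {z : ℤ | (Δ : ℤ) ≤ |z - (u.numColors : ℤ)|})
    (I := Ioo ((u.numColors : ℤ) - Δ) (u.numColors + Δ)) (fun z => by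
      simp only [Set.mem_ofPred_eq, mem_Ioo]
      by_cases hz : (Δ : ℤ) ≤ |z - (u.numColors : ℤ)|
      · exact Or.inl hz
      · right
        rw [not_le, abs_lt] at hz
        constructor <;> linarith [hz.1, hz.2])
  unfold errorProb at h
  have h2 : ∀ z : ℤ, (((u.sampleLaw n).bind Chat) z).toReal
      = ((k : ℝ) ^ n)⁻¹ * ∑ s : Fin n → Fin k, (Chat (fun i => u (s i)) z).toReal := by
    intro z
    rw [Urn.sampleLaw, PMF.bind_map, PMF.bind_apply, tsum_fintype,
      ENNReal.toReal_sum (fun s _ => ENNReal.mul_ne_top (PMF.apply_ne_top _ _)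
        (PMF.apply_ne_top _ _)), mul_sum]
    refine sum_congr rfl fun s _ => ?_
    simp [ENNReal.toReal_mul]
  simp_rw [h2] at h1
  rw [← mul_sum, sum_comm] at h1
  have h3 : (0.9 : ℝ) ≤ ((k : ℝ) ^ n)⁻¹ * ∑ s : Fin n → Fin k,
      ∑ z ∈ Ioo ((u.numColors : ℤ) - Δ) (u.numColors + Δ),
        (Chat (fun i => u (s i)) z).toReal := by
    linarith
  rw [inv_mul_eq_div, le_div_iff₀ (by positivity)] at h3
  exact h3

/-- Two colour sequences with the same equality pattern differ by a permutation of the colours. -/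
theorem exists_perm_of_eq_iff_eq {ι α : Type*} [Finite α] {y y' : ι → α}
    (h : ∀ i j, y i = y j ↔ y' i = y' j) : ∃ σ : Equiv.Perm α, ∀ i, y' i = σ (y i) := by
  classical
  -- The chosen index is arbitrary; `h` makes the value of `y'` independent of it.
  let g : {x // x ∈ Set.range y} → {x // x ∈ Set.range y'} :=
    fun x => ⟨y' x.2.choose, ⟨_, rfl⟩⟩
  have hg : ∀ i, (g ⟨y i, i, rfl⟩ : α) = y' i := by
    intro i
    exact (h _ _).1 (Exists.choose_spec (p := fun j => y j = y i) ⟨i, rfl⟩)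
  have hb : Function.Bijective g := by
    constructor
    · rintro ⟨_, i, rfl⟩ ⟨_, j, rfl⟩ hij
      have := congrArg Subtype.val hij
      rw [hg, hg] at this
      exact Subtype.ext ((h i j).2 this)
    · rintro ⟨_, i, rfl⟩
      exact ⟨⟨y i, i, rfl⟩, Subtype.ext (hg i)⟩
  have := Fintype.ofFinite α
  refine ⟨(Equiv.ofBijective g hb).extendSubtype, fun i => ?_⟩
  rw [Equiv.extendSubtype_apply_of_mem _ (y i) ⟨i, rfl⟩]
  exact (hg i).symm

/-- A relabelling-invariant estimator: nonnegative weights `q y z` of total mass at most one in `z`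
that depend on the colour sequence `y` only through its equality pattern, and that put on average
mass at least `0.9` within distance less than `Δ` of the true number of colours. -/
structure InvariantEstimator (k Δ n : ℕ) where
  q : (Fin n → Fin k) → ℤ → ℝ
  nonneg : ∀ y z, 0 ≤ q y z
  sum_le_one : ∀ y (I : Finset ℤ), ∑ z ∈ I, q y z ≤ 1
  invariant : ∀ y y', (∀ i j, y i = y j ↔ y' i = y' j) → q y = q y'
  success : ∀ u : Fin k → Fin k, 0.9 * (k : ℝ) ^ n ≤ ∑ s : Fin n → Fin k,
    ∑ z ∈ Ioo (((univ.image u).card : ℤ) - Δ) ((univ.image u).card + Δ), q (fun i => u (s i)) z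

/-- Averaging an estimator over all relabellings of the colours makes it invariant. -/
theorem Suffices.exists_invariantEstimator {k : ℕ} [NeZero k] {Δ n : ℕ} (h : Suffices k Δ n) :
    Nonempty (InvariantEstimator k Δ n) := by
  obtain ⟨Chat, hC⟩ := h
  have hN : (0 : ℝ) < (Fintype.card (Equiv.Perm (Fin k)) : ℝ) := by
    exact_mod_cast Fintype.card_pos
  refine ⟨⟨fun y z => (Fintype.card (Equiv.Perm (Fin k)) : ℝ)⁻¹ *
    ∑ π : Equiv.Perm (Fin k), (Chat (fun i => (π (y i) : ℕ)) z).toReal, ?_, ?_, ?_, ?_⟩⟩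
  · intro y z
    positivity
  · intro y I
    rw [← mul_sum, sum_comm, inv_mul_le_iff₀ hN]
    calc _ ≤ ∑ π : Equiv.Perm (Fin k), (1 : ℝ) := sum_le_sum fun π _ => toReal_sum_le_one _ _
      _ = _ := by simp
  · intro y y' hy
    obtain ⟨σ, hσ⟩ := exists_perm_of_eq_iff_eq hy
    funext z
    congr 1
    -- Replacing y by σ ∘ y only permutes the terms of the average, via π ↦ π * σ.
    rw [← Equiv.sum_comp (Equiv.mulRight σ)]
    refine sum_congr rfl fun π _ => ?_
    simp [hσ]
  · intro u
    have hπ : ∀ π : Equiv.Perm (Fin k), 0.9 * (k : ℝ) ^ n ≤ ∑ s : Fin n → Fin k,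
        ∑ z ∈ Ioo (((univ.image u).card : ℤ) - Δ) ((univ.image u).card + Δ),
          (Chat (fun i => (π (u (s i)) : ℕ)) z).toReal := by
      intro π
      have h1 := success_of_errorProb_le (hC (fun x => (π (u x) : ℕ)))
      have h2 : Urn.numColors (fun x => (π (u x) : ℕ)) = (univ.image u).card := by
        unfold Urn.numColors
        rw [← card_image_of_injective (univ.image u) (Fin.val_injective.comp π.injective),
          image_image]
        rfl
      rw [h2] at h1
      exact h1
    have h3 := sum_le_sum fun (π : Equiv.Perm (Fin k)) (_ : π ∈ univ) => hπ π
    rw [sum_const, card_univ, nsmul_eq_mul, ← le_inv_mul_iff₀ hN] at h3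
    refine h3.trans (le_of_eq ?_)
    rw [sum_comm, mul_sum]
    refine sum_congr rfl fun s _ => ?_
    rw [sum_comm, mul_sum]

/-! ### Counting collisions among the draws. -/

/-- Double counting by resampling draw j: the pair (s, y) goes to the sequence with y in place j
together with the old value `s j`, which lies in the fibre of `f (s i)`. As i ≠ j, that fibre is
unaffected by the swap. -/
theorem card_filter_apply_eq_mul_le {α β : Type*} [Fintype α] [DecidableEq α] [DecidableEq β]
    (f : α → β) {n L : ℕ} (hL : ∀ x, (univ.filter fun y => f y = f x).card ≤ L) {i j : Fin n}
    (hij : i ≠ j) :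
    (univ.filter fun s : Fin n → α => f (s i) = f (s j)).card * Fintype.card α
      ≤ L * Fintype.card α ^ n := by
  rw [← card_univ, ← card_product]
  have h1 : ((univ.filter fun s : Fin n → α => f (s i) = f (s j)) ×ˢ (univ : Finset α)).card ≤
      ((univ : Finset (Fin n → α)).sigma fun s => univ.filter fun y => f y = f (s i)).card := by
    refine card_le_card_of_injOn (fun p => ⟨Function.update p.1 j p.2, p.1 j⟩) ?_ ?_
    · rintro ⟨s, y⟩ hs
      simp only [coe_product, Set.mem_prod, mem_coe, mem_filter, mem_univ, true_and, and_true]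
        at hs
      simp [hij, hs]
    · rintro ⟨s, y⟩ _ ⟨s', y'⟩ _ h
      simp only [Sigma.mk.injEq, heq_eq_eq] at h
      have hy : y = y' := by simpa using congrFun h.1 j
      refine Prod.ext (funext fun l => ?_) hy
      by_cases hl : l = j
      · rw [hl]; exact h.2
      · simpa [hl] using congrFun h.1 l
  refine h1.trans ?_
  rw [card_sigma]
  calc _ ≤ ∑ s : Fin n → α, L := sum_le_sum fun s _ => hL _
    _ = _ := by simp [mul_comm]

/-- First moment of the number of ordered pairs of draws with the same value of `f`. -/
theorem sum_card_collisions_mul_le {α β : Type*} [Fintype α] [DecidableEq α] [DecidableEq β]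
    (f : α → β) {n L : ℕ} (hL : ∀ x, (univ.filter fun y => f y = f x).card ≤ L) :
    (∑ s : Fin n → α, (univ.offDiag.filter fun p : Fin n × Fin n => f (s p.1) = f (s p.2)).card)
      * Fintype.card α ≤ n ^ 2 * (L * Fintype.card α ^ n) := by
  simp_rw [card_filter]
  rw [sum_comm, sum_mul]
  calc _ ≤ ∑ p ∈ (univ : Finset (Fin n)).offDiag, L * Fintype.card α ^ n := by
        refine sum_le_sum fun p hp => ?_
        rw [← card_filter]
        exact card_filter_apply_eq_mul_le f hL (mem_offDiag.1 hp).2.2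
    _ ≤ _ := by
        rw [sum_const, smul_eq_mul]
        gcongr
        rw [offDiag_card, card_univ, Fintype.card_fin, sq]
        exact Nat.sub_le _ _

end DistinctElements

/-! ### Size of the middle binomial coefficient. -/

namespace DistinctElements

theorem centralBinom_sq_mul_le (n : ℕ) : n.centralBinom ^ 2 * (2 * n + 1) ≤ 16 ^ n := by
  induction n with
  | zero => simp
  | succ n ih =>
    have h := Nat.succ_mul_centralBinom_succ n
    have h3 : (2 * n + 1) * (2 * n + 3) ≤ 4 * (n + 1) ^ 2 := by nlinarith
    have h2 : (n + 1) ^ 2 * ((n + 1).centralBinom ^ 2 * (2 * (n + 1) + 1))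
        ≤ (n + 1) ^ 2 * 16 ^ (n + 1) := by
      calc (n + 1) ^ 2 * ((n + 1).centralBinom ^ 2 * (2 * (n + 1) + 1))
          = ((n + 1) * (n + 1).centralBinom) ^ 2 * (2 * n + 3) := by ring
        _ = (n.centralBinom ^ 2 * (2 * n + 1)) * (4 * ((2 * n + 1) * (2 * n + 3))) := by
            rw [h]; ring
        _ ≤ 16 ^ n * (4 * (4 * (n + 1) ^ 2)) := by
            gcongr
        _ = _ := by ring
    exact Nat.le_of_mul_le_mul_left h2 (by positivity)

theorem choose_half_sq_mul_le (R : ℕ) : (R.choose (R / 2)) ^ 2 * (R + 1) ≤ 4 ^ R := by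
  obtain ⟨m, rfl | rfl⟩ := R.even_or_odd'
  · have h := centralBinom_sq_mul_le m
    rw [Nat.centralBinom_eq_two_mul_choose] at h
    rw [show 2 * m / 2 = m by omega, pow_mul]
    exact h
  · have h := centralBinom_sq_mul_le (m + 1)
    -- A middle coefficient of an odd row is half the central one of the next row.
    have h2 : (m + 1).centralBinom = 2 * (2 * m + 1).choose m := by
      rw [Nat.centralBinom_eq_two_mul_choose, show 2 * (m + 1) = 2 * m + 1 + 1 by ring,
        Nat.choose_succ_succ, Nat.choose_symm_half]
      ring
    rw [show (2 * m + 1) / 2 = m by omega]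
    rw [h2] at h
    have e : (4 : ℕ) ^ (2 * m + 1) * 4 = 16 ^ (m + 1) := by
      rw [show (16 : ℕ) = 4 ^ 2 by norm_num, ← pow_mul, ← pow_succ]
      ring_nf
    nlinarith [Nat.zero_le ((2 * m + 1).choose m ^ 2)]

/-- The largest binomial coefficient is small compared with `2 ^ R`. -/
theorem two_mul_mul_choose_half_le {w R : ℕ} (h : 4 * w ^ 2 ≤ R + 1) :
    2 * w * R.choose (R / 2) ≤ 2 ^ R := by
  have h1 := choose_half_sq_mul_le R
  refine (Nat.pow_le_pow_iff_left (n := 2) two_ne_zero).1 ?_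
  calc (2 * w * R.choose (R / 2)) ^ 2 = R.choose (R / 2) ^ 2 * (4 * w ^ 2) := by ring
    _ ≤ R.choose (R / 2) ^ 2 * (R + 1) := by gcongr
    _ ≤ 4 ^ R := h1
    _ = (2 ^ R) ^ 2 := by rw [← pow_mul, mul_comm, pow_mul]; norm_num

/-! ### Elementary estimates for arcosh. -/

open Real

/-- For u = √(2x), cosh u = 1 + 2 sinh²(u/2) ≥ 1 + u²/2 = 1 + x. -/
theorem arcosh_one_add_le_sqrt {x : ℝ} (hx : 0 ≤ x) : arcosh (1 + x) ≤ √(2 * x) := by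
  rw [← arcosh_cosh (sqrt_nonneg (2 * x)), arcosh_le_arcosh (by linarith) (cosh_pos _)]
  have h1 : √(2 * x) / 2 ≤ sinh (√(2 * x) / 2) := self_le_sinh_iff.2 (by positivity)
  have h2 : cosh √(2 * x) = 1 + 2 * sinh (√(2 * x) / 2) ^ 2 := by
    have := cosh_two_mul (√(2 * x) / 2)
    rw [mul_div_cancel₀ _ two_ne_zero, cosh_sq] at this
    linarith
  have h3 : (√(2 * x) / 2) ^ 2 ≤ sinh (√(2 * x) / 2) ^ 2 :=
    pow_le_pow_left₀ (by positivity) h1 2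
  rw [div_pow, sq_sqrt (by linarith)] at h3
  linarith

theorem arcosh_one_add_eq (x : ℝ) : arcosh (1 + x) = log (1 + (x + √(2 * x + x ^ 2))) := by
  rw [arcosh, show (1 + x) ^ 2 - 1 = 2 * x + x ^ 2 by ring, add_assoc]

/-- With x = k/(4Δ²), the threshold 1/4 corresponds to Δ = √k. -/
theorem arcosh_one_add_le_log {x : ℝ} (hx : 1 / 4 ≤ x) :
    arcosh (1 + x) ≤ 2 * log (1 + 4 * x) := by
  have h0 : √(2 * x + x ^ 2) ≤ x + 1 := by
    rw [sqrt_le_left (by linarith)]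
    nlinarith
  have h1 : 2 * log (1 + 4 * x) = log ((1 + 4 * x) ^ 2) := by
    rw [log_pow]; norm_num
  rw [arcosh_one_add_eq, h1]
  exact log_le_log (by positivity) (by nlinarith)

theorem log_le_arcosh_one_add {x : ℝ} (hx : 0 ≤ x) :
    1 / 2 * log (1 + 4 * x) ≤ arcosh (1 + x) := by
  have h0 : x ≤ √(2 * x + x ^ 2) := le_sqrt_of_sq_le (by nlinarith)
  have h1 : log (1 + 4 * x) ≤ 2 * log (1 + (x + √(2 * x + x ^ 2))) := by
    have e : 2 * log (1 + (x + √(2 * x + x ^ 2))) = log ((1 + (x + √(2 * x + x ^ 2))) ^ 2) := by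
      rw [log_pow]; norm_num
    rw [e]
    exact log_le_log (by positivity) (by nlinarith)
  rw [arcosh_one_add_eq]
  linarith

theorem sqrt_le_arcosh_one_add {x : ℝ} (hx : 0 ≤ x) (hx' : x ≤ 1 / 2) :
    1 / 2 * √(2 * x) ≤ arcosh (1 + x) := by
  have h1 : √(2 * x) ≤ √(2 * x + x ^ 2) := sqrt_le_sqrt (by nlinarith)
  have h2 : √(2 * x) ≤ 1 := by
    rw [sqrt_le_one]; linarith
  have h3 := one_sub_inv_le_log_of_pos (show 0 < 1 + √(2 * x) by positivity)
  have h4 : log (1 + √(2 * x)) ≤ arcosh (1 + x) := by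
    rw [arcosh_one_add_eq]
    exact log_le_log (by positivity) (by linarith)
  refine le_trans ?_ (h3.trans h4)
  have h5 : 1 - (1 + √(2 * x))⁻¹ = √(2 * x) / (1 + √(2 * x)) := by field_simp; ring
  rw [h5, le_div_iff₀ (by positivity)]
  nlinarith [sqrt_nonneg (2 * x)]

end DistinctElements

/-! ### Urns with randomly merged blocks of pairs. -/

namespace DistinctElements

open Finset

variable {k n : ℕ}

/-- The `k` balls are grouped into pairs `{2 * p, 2 * p + 1}` and the pairs into blocks of size `t`.
In this urn the two balls of a pair have the same colour if the block of the pair is in `e`; all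
other balls have different colours. -/
def mergeUrn (t : ℕ) (e : Finset ℕ) (x : Fin k) : Fin k :=
  if (x : ℕ) / 2 / t ∈ e then ⟨2 * (x / 2), (Nat.mul_div_le _ _).trans_lt x.2⟩ else x

theorem mergeUrn_eq_iff {t : ℕ} {e : Finset ℕ} {x y : Fin k} :
    mergeUrn t e x = mergeUrn t e y ↔
      x = y ∨ ((x : ℕ) / 2 = y / 2 ∧ (x : ℕ) / 2 / t ∈ e) := by
  have hv : ∀ z : Fin k, (mergeUrn t e z : ℕ) / 2 = z / 2 := by
    intro z
    unfold mergeUrn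
    split_ifs
    · simp
    · rfl
  constructor
  · intro h
    have h1 : (x : ℕ) / 2 = y / 2 := by rw [← hv x, ← hv y, h]
    by_cases hx : (x : ℕ) / 2 / t ∈ e
    · exact Or.inr ⟨h1, hx⟩
    · left
      rwa [mergeUrn, if_neg hx, mergeUrn, if_neg (by rwa [← h1])] at h
  · rintro (rfl | ⟨h1, h2⟩)
    · rfl
    · rw [mergeUrn, if_pos h2, mergeUrn, if_pos (by rwa [← h1])]
      simp [h1]

/-- Each merged pair loses exactly the colour of its odd ball, and `hB` guarantees that the first
`B` blocks consist of t complete pairs. -/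
theorem card_image_mergeUrn {t B : ℕ} (ht : 1 ≤ t) (hB : 2 * t * B ≤ k) {e : Finset ℕ}
    (he : e ⊆ range B) :
    (univ.image (mergeUrn t e : Fin k → Fin k)).card + t * e.card = k := by
  have himg : univ.image (mergeUrn t e : Fin k → Fin k)
      = univ.filter fun x : Fin k => ¬ ((x : ℕ) % 2 = 1 ∧ (x : ℕ) / 2 / t ∈ e) := by
    ext x
    simp only [mem_image, mem_univ, true_and, mem_filter]
    constructor
    · rintro ⟨y, rfl⟩ ⟨h1, h2⟩
      unfold mergeUrn at h1 h2
      split_ifs at h1 h2 with hy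
      · simp at h1
      · exact hy h2
    · intro hx
      refine ⟨x, ?_⟩
      unfold mergeUrn
      split_ifs with hxe
      · refine Fin.ext ?_
        have : (x : ℕ) % 2 ≠ 1 := fun h => hx ⟨h, hxe⟩
        simp only
        omega
      · rfl
  have hrem : (univ.filter fun x : Fin k => (x : ℕ) % 2 = 1 ∧ (x : ℕ) / 2 / t ∈ e).card
      = (e ×ˢ range t).card := by
    refine card_nbij (fun x => ((x : ℕ) / 2 / t, (x : ℕ) / 2 % t)) ?_ ?_ ?_
    · intro x hx
      simp only [coe_filter, mem_univ, true_and, Set.mem_ofPred_eq] at hx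
      simpa [hx.2] using Nat.mod_lt _ ht
    · intro x hx y hy h
      simp only [coe_filter, mem_univ, true_and, Set.mem_ofPred_eq] at hx hy
      simp only [Prod.mk.injEq] at h
      have h1 : (x : ℕ) / 2 = y / 2 := by
        rw [← Nat.div_add_mod ((x : ℕ) / 2) t, ← Nat.div_add_mod ((y : ℕ) / 2) t, h.1, h.2]
      refine Fin.ext ?_
      omega
    · rintro ⟨j, i⟩ h
      simp only [coe_product, Set.mem_prod, mem_coe, mem_range] at h
      have hj : j < B := mem_range.1 (he h.1)
      have h1 : 2 * (t * j + i) + 1 < k := by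
        have : t * (j + 1) ≤ t * B := Nat.mul_le_mul_left _ hj
        have h2 : 2 * t * B = 2 * (t * B) := by ring
        rw [mul_add] at this
        omega
      have h3 : (2 * (t * j + i) + 1) / 2 = t * j + i := by omega
      have h4 : (t * j + i) / t = j := by
        rw [Nat.mul_add_div ht, Nat.div_eq_of_lt h.2, add_zero]
      have h5 : (t * j + i) % t = i := by
        rw [Nat.mul_add_mod, Nat.mod_eq_of_lt h.2]
      refine ⟨⟨2 * (t * j + i) + 1, h1⟩, ?_, ?_⟩
      · simp only [coe_filter, mem_univ, true_and, Set.mem_ofPred_eq, h3, h4]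
        exact ⟨by omega, h.1⟩
      · simp only [h3, h4, h5]
  have hsum := card_filter_add_card_filter_not (s := (univ : Finset (Fin k)))
    (fun x : Fin k => (x : ℕ) % 2 = 1 ∧ (x : ℕ) / 2 / t ∈ e)
  rw [himg]
  rw [hrem, card_product, card_range, card_univ, Fintype.card_fin] at hsum
  linarith [mul_comm t e.card]

/-- The blocks that contain a pair of which both balls have been drawn. -/
def revealed (t B : ℕ) (s : Fin n → Fin k) : Finset ℕ :=
  (range B).filter fun j => ∃ i i', s i ≠ s i' ∧ (s i : ℕ) / 2 = s i' / 2 ∧ (s i : ℕ) / 2 / t = j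

/-- Two different balls of equal colour, once drawn, themselves reveal their block. So the pattern
depends on `e` only through the revealed blocks. -/
theorem mergeUrn_eq_iff_inter_revealed {t B : ℕ} {e : Finset ℕ} (he : e ⊆ range B)
    (s : Fin n → Fin k) (i j : Fin n) :
    mergeUrn t e (s i) = mergeUrn t e (s j) ↔
      mergeUrn t (e ∩ revealed t B s) (s i) = mergeUrn t (e ∩ revealed t B s) (s j) := by
  rw [mergeUrn_eq_iff, mergeUrn_eq_iff]
  by_cases h : s i = s j
  · simp [h]
  simp only [h, false_or, mem_inter]
  refine and_congr_right fun h1 => ⟨fun h2 => ⟨h2, ?_⟩, fun h2 => h2.1⟩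
  exact mem_filter.2 ⟨he h2, i, j, h, h1, rfl⟩

/-- The number of subsets of `T` whose cardinality, multiplied by `t`, lies in a given window. -/
theorem card_powerset_filter_window_le {T : Finset ℕ} {t Δ : ℕ} (ht : 1 ≤ t) (a : ℤ) :
    (T.powerset.filter fun A => |a - t * (A.card : ℤ)| < Δ).card
      ≤ (2 * Δ / t + 1) * T.card.choose (T.card / 2) := by
  set J := (range (T.card + 1)).filter fun j : ℕ => |a - t * (j : ℤ)| < Δ with hJ
  have hJcard : J.card ≤ 2 * Δ / t + 1 := by
    rcases J.eq_empty_or_nonempty with h | h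
    · simp [h]
    -- Two elements of `J` have multiples by t that differ by less than 2Δ.
    · have : J ⊆ Icc (J.min' h) (J.min' h + 2 * Δ / t) := by
        intro j hj
        have h1 := J.min'_le j hj
        have h2 := (mem_filter.1 (J.min'_mem h)).2
        have h3 := (mem_filter.1 hj).2
        rw [mem_Icc]
        refine ⟨h1, ?_⟩
        rw [← Nat.sub_le_iff_le_add', Nat.le_div_iff_mul_le ht]
        zify [h1]
        rw [abs_lt] at h2 h3
        nlinarith [h2.1, h2.2, h3.1, h3.2]
      refine (card_le_card this).trans (le_of_eq ?_)
      rw [Nat.card_Icc, add_assoc, Nat.add_sub_cancel_left]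
  have hsub : (T.powerset.filter fun A => |a - t * (A.card : ℤ)| < Δ)
      ⊆ J.biUnion fun j => powersetCard j T := by
    intro A hA
    rw [mem_filter, mem_powerset] at hA
    rw [mem_biUnion]
    refine ⟨A.card, ?_, mem_powersetCard.2 ⟨hA.1, rfl⟩⟩
    rw [hJ, mem_filter, mem_range, Nat.lt_succ_iff]
    exact ⟨card_le_card hA.1, hA.2⟩
  refine (card_le_card hsub).trans (card_biUnion_le.trans ?_)
  calc _ ≤ ∑ j ∈ J, T.card.choose (T.card / 2) := by
        refine sum_le_sum fun j _ => ?_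
        rw [card_powersetCard]
        exact Nat.choose_le_middle _ _
    _ ≤ _ := by
        rw [sum_const, smul_eq_mul]
        gcongr

/-- The success mass of an estimator in the urns `mergeUrn t e` for a fixed sequence of draws,
summed over all `e`, is limited by the number of urns that cannot be told apart. -/
theorem InvariantEstimator.sum_mergeUrn_le {Δ t B : ℕ} (E : InvariantEstimator k Δ n)
    (s : Fin n → Fin k) {W : ℕ}
    (hW : ∀ a : ℤ, (((range B \ revealed t B s).powerset).filter
      fun A => |a - t * (A.card : ℤ)| < Δ).card ≤ W) :
    ∑ e ∈ (range B).powerset, ∑ z ∈ Ioo (((k : ℤ) - t * (e.card : ℤ)) - Δ)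
        (((k : ℤ) - t * (e.card : ℤ)) + Δ), E.q (fun i => mergeUrn t e (s i)) z
      ≤ 2 ^ (revealed t B s).card * W := by
  set S := revealed t B s with hS
  have hSB : S ⊆ range B := filter_subset _ _
  have hmaps : ∀ e ∈ (range B).powerset, e ∩ S ∈ S.powerset := fun e _ =>
    mem_powerset.2 inter_subset_right
  rw [← sum_fiberwise_of_maps_to hmaps]
  -- Once the trace `A` on the revealed blocks is fixed, the estimator has one weight function;
  -- after exchanging sums, each answer z is acceptable for at most `W` of the sets e.
  have hA : ∀ A ∈ S.powerset, ∑ e ∈ (range B).powerset with e ∩ S = A,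
      ∑ z ∈ Ioo (((k : ℤ) - t * (e.card : ℤ)) - Δ) (((k : ℤ) - t * (e.card : ℤ)) + Δ),
        E.q (fun i => mergeUrn t e (s i)) z ≤ (W : ℝ) := by
    intro A _
    set Z : Finset ℤ := (range B).powerset.biUnion fun e =>
      Ioo (((k : ℤ) - t * (e.card : ℤ)) - Δ) (((k : ℤ) - t * (e.card : ℤ)) + Δ) with hZ
    set w : ℤ → ℝ := E.q fun i => mergeUrn t A (s i) with hw
    calc _ = ∑ e ∈ (range B).powerset with e ∩ S = A, ∑ z ∈ Z,
          if |((k : ℤ) - z) - t * (e.card : ℤ)| < Δ then w z else 0 := by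
          refine sum_congr rfl fun e he => ?_
          rw [mem_filter, mem_powerset] at he
          have h1 : E.q (fun i => mergeUrn t e (s i)) = w := by
            refine E.invariant _ _ fun i j => ?_
            rw [← he.2]
            exact mergeUrn_eq_iff_inter_revealed he.1 s i j
          rw [h1, ← sum_filter]
          refine sum_congr ?_ fun _ _ => rfl
          ext z
          rw [mem_filter, hZ, mem_biUnion, mem_Ioo, abs_lt]
          constructor
          · intro hz
            refine ⟨⟨e, mem_powerset.2 he.1, mem_Ioo.2 hz⟩, ?_, ?_⟩ <;> linarith [hz.1, hz.2]
          · rintro ⟨_, h2, h3⟩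
            constructor <;> linarith
      _ = ∑ z ∈ Z, ((((range B).powerset.filter fun e => e ∩ S = A).filter
            fun e => |((k : ℤ) - z) - t * (e.card : ℤ)| < Δ).card : ℝ) * w z := by
          rw [sum_comm]
          refine sum_congr rfl fun z _ => ?_
          rw [← sum_filter, sum_const, nsmul_eq_mul]
      _ ≤ ∑ z ∈ Z, (W : ℝ) * w z := by
          refine sum_le_sum fun z _ => mul_le_mul_of_nonneg_right ?_ (E.nonneg _ _)
          refine Nat.cast_le.2 (le_trans ?_ (hW ((k : ℤ) - z - t * (A.card : ℤ))))
          refine card_le_card_of_injOn (fun e => e \ S) ?_ ?_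
          · intro e he
            simp only [coe_filter, mem_filter, mem_powerset, Set.mem_ofPred_eq] at he ⊢
            refine ⟨sdiff_subset_sdiff he.1.1 le_rfl, ?_⟩
            have hc : (e.card : ℤ) = A.card + (e \ S).card := by
              rw [← he.1.2]
              exact_mod_cast (card_inter_add_card_sdiff e S).symm
            have := he.2
            rw [hc] at this
            rwa [sub_sub, ← mul_add]
          · intro e he e' he' h
            simp only [coe_filter, mem_filter, mem_powerset, Set.mem_ofPred_eq] at he he'
            have h' : e \ S = e' \ S := h
            rw [← sdiff_union_inter e S, ← sdiff_union_inter e' S, h', he.1.2, he'.1.2]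
      _ ≤ (W : ℝ) := by
          rw [← mul_sum]
          exact mul_le_of_le_one_right (Nat.cast_nonneg _) (E.sum_le_one _ _)
  refine (sum_le_sum hA).trans (le_of_eq ?_)
  simp [card_powerset]

/-- If `n` samples suffice, then it is unlikely that `r` or more blocks remain unrevealed. -/
theorem InvariantEstimator.card_unrevealed_le {Δ t B r : ℕ} (E : InvariantEstimator k Δ n)
    (ht : 1 ≤ t) (hB : 2 * t * B ≤ k) (hr : 4 * (2 * Δ / t + 1) ^ 2 ≤ r) :
    5 * (univ.filter fun s : Fin n → Fin k => r + (revealed t B s).card ≤ B).card ≤ k ^ n := by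
  set G := univ.filter fun s : Fin n → Fin k => r + (revealed t B s).card ≤ B with hG
  have hS : ∀ s : Fin n → Fin k, (range B \ revealed t B s).card + (revealed t B s).card = B := by
    intro s
    rw [card_sdiff_add_card_eq_card (show revealed t B s ⊆ range B from filter_subset _ _),
      card_range]
  have hbound : ∀ s : Fin n → Fin k, ∑ e ∈ (range B).powerset,
      ∑ z ∈ Ioo (((k : ℤ) - t * (e.card : ℤ)) - Δ) (((k : ℤ) - t * (e.card : ℤ)) + Δ),
        E.q (fun i => mergeUrn t e (s i)) z ≤ (2 : ℝ) ^ B * (1 - if s ∈ G then 1 / 2 else 0) := by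
    intro s
    have hpow : (2 : ℝ) ^ B = 2 ^ (revealed t B s).card * 2 ^ (range B \ revealed t B s).card := by
      rw [← pow_add, add_comm, hS s]
    rw [hpow]
    split_ifs with hs
    · refine (E.sum_mergeUrn_le s fun a => card_powerset_filter_window_le ht a).trans ?_
      rw [mul_assoc]
      gcongr
      have h1 : r + (revealed t B s).card ≤ B := (mem_filter.1 hs).2
      have h2 := two_mul_mul_choose_half_le (w := 2 * Δ / t + 1)
        (R := (range B \ revealed t B s).card) (by have := hS s; omega)
      have h3 : 2 * ((((2 * Δ / t + 1) * (range B \ revealed t B s).card.choose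
          ((range B \ revealed t B s).card / 2) : ℕ)) : ℝ)
          ≤ (2 : ℝ) ^ (range B \ revealed t B s).card := by
        rw [mul_assoc] at h2
        exact_mod_cast h2
      linarith
    · rw [sub_zero, mul_one]
      refine (E.sum_mergeUrn_le s (W := 2 ^ (range B \ revealed t B s).card) fun a => ?_).trans
        (by simp)
      exact (card_filter_le _ _).trans (card_powerset _).le
  have hsucc : ∀ e ∈ (range B).powerset, 0.9 * (k : ℝ) ^ n ≤ ∑ s : Fin n → Fin k,
      ∑ z ∈ Ioo (((k : ℤ) - t * (e.card : ℤ)) - Δ) (((k : ℤ) - t * (e.card : ℤ)) + Δ),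
        E.q (fun i => mergeUrn t e (s i)) z := by
    intro e he
    have h1 := E.success (mergeUrn t e)
    have h2 : ((univ.image (mergeUrn t e : Fin k → Fin k)).card : ℤ) = k - t * (e.card : ℤ) := by
      have := card_image_mergeUrn ht hB (mem_powerset.1 he)
      rw [eq_sub_iff_add_eq]
      exact_mod_cast this
    rwa [h2] at h1
  have h1 := sum_le_sum hsucc
  rw [sum_comm, sum_const, card_powerset, card_range, nsmul_eq_mul] at h1
  have h2 := h1.trans (sum_le_sum fun s _ => hbound s)
  rw [← mul_sum, Nat.cast_pow, Nat.cast_two] at h2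
  -- Averaging over all `2 ^ B` urns leaves 0.9 ≤ 1 - P(G)/2, hence P(G) ≤ 1/5.
  have h3 := le_of_mul_le_mul_left h2 (by positivity)
  rw [sum_sub_distrib, sum_ite_mem, univ_inter] at h3
  simp only [sum_const, card_univ, Fintype.card_pi, Fintype.card_fin, prod_const, nsmul_eq_mul,
    mul_one, Nat.cast_pow] at h3
  have h4 : 5 * (G.card : ℝ) ≤ (k : ℝ) ^ n := by linarith
  exact_mod_cast h4

end DistinctElements

/-! ### The birthday bound. -/

namespace DistinctElements

open Finset

namespace InvariantEstimator

variable {k Δ n : ℕ}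

theorem sum_add_sum_le_one (E : InvariantEstimator k Δ n) {y y' : Fin n → Fin k}
    (h : ∀ i j, y i = y j ↔ y' i = y' j) {I J : Finset ℤ} (hIJ : Disjoint I J) :
    ∑ z ∈ I, E.q y z + ∑ z ∈ J, E.q y' z ≤ 1 := by
  rw [← E.invariant y y' h, ← sum_union hIJ]
  exact E.sum_le_one _ _

/-- Samples without colour collisions do not distinguish `m + 2 * Δ` distinct colours from `m`
equally frequent ones. -/
theorem le_four_mul_sq {m : ℕ} (hm : 1 ≤ m) (E : InvariantEstimator (m + 2 * Δ) Δ n) :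
    m ≤ 4 * n ^ 2 := by
  classical
  set k := m + 2 * Δ with hk
  have hk0 : 0 < k := by omega
  let f : Fin k → Fin k := fun x => ⟨x % m, (Nat.mod_lt _ hm).trans_le (by omega)⟩
  have hf : ∀ x y : Fin k, f x = f y ↔ (x : ℕ) % m = y % m := fun x y => by simp [f]
  have hcard : (univ.image f).card = m := by
    have : univ.image f = univ.filter fun x : Fin k => (x : ℕ) < m := by
      ext x
      simp only [mem_image, mem_univ, true_and, mem_filter]
      constructor
      · rintro ⟨y, rfl⟩
        exact Nat.mod_lt _ hm
      · intro hx
        exact ⟨x, Fin.ext (Nat.mod_eq_of_lt hx)⟩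
    rw [this, Fin.card_filter_val_lt]
    omega
  have hL : ∀ x, (univ.filter fun y => f y = f x).card ≤ k / m + 1 := by
    intro x
    rw [← card_range (k / m + 1)]
    refine card_le_card_of_injOn (fun y => (y : ℕ) / m) ?_ ?_
    · intro y _
      simpa [Nat.lt_succ_iff] using Nat.div_le_div_right y.2.le
    · intro y hy y' hy' h
      simp only [coe_filter, mem_univ, true_and, Set.mem_ofPred_eq, hf] at hy hy'
      have h' : (y : ℕ) / m = y' / m := h
      refine Fin.ext ?_
      rw [← Nat.div_add_mod y m, ← Nat.div_add_mod y' m, h', hy, hy']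
  have hcoll := sum_card_collisions_mul_le f (n := n) hL
  rw [Fintype.card_fin] at hcoll
  set G : Finset (Fin n → Fin k) := univ.filter fun s => Function.Injective fun i => f (s i) with hG
  have hbad : Gᶜ.card * k ≤ n ^ 2 * ((k / m + 1) * k ^ n) := by
    refine le_trans (Nat.mul_le_mul_right _ ?_) hcoll
    rw [card_eq_sum_ones]
    refine le_trans (sum_le_sum fun s hs => ?_)
      (sum_le_sum_of_subset (f := fun s : Fin n → Fin k =>
        (univ.offDiag.filter fun p : Fin n × Fin n => f (s p.1) = f (s p.2)).card)
        (subset_univ Gᶜ))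
    rw [Nat.one_le_iff_ne_zero, ← Nat.pos_iff_ne_zero, card_pos]
    have hs' : ¬ Function.Injective fun i => f (s i) := fun h =>
      mem_compl.1 hs (mem_filter.2 ⟨mem_univ _, h⟩)
    simp only [Function.Injective, not_forall] at hs'
    obtain ⟨i, j, h1, h2⟩ := hs'
    exact ⟨(i, j), by simp [h1, h2]⟩
  have h1 := E.success id
  have h2 := E.success f
  rw [hcard] at h2
  rw [image_id, card_univ, Fintype.card_fin] at h1
  have hdis : Disjoint (Ioo ((k : ℤ) - Δ) (k + Δ)) (Ioo ((m : ℤ) - Δ) (m + Δ)) := by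
    rw [disjoint_left]
    intro z hz hz'
    simp only [mem_Ioo] at hz hz'
    omega
  -- A collision-free sample gives total success at most 1 in the two urns, any other at most 2; so
  -- collisions have probability at least 0.8.
  have h3 : 0.9 * (k : ℝ) ^ n + 0.9 * (k : ℝ) ^ n ≤
      ∑ s : Fin n → Fin k, (1 + if s ∈ Gᶜ then (1 : ℝ) else 0) := by
    refine (add_le_add h1 h2).trans ?_
    rw [← sum_add_distrib]
    refine sum_le_sum fun s _ => ?_
    by_cases hs : s ∈ G
    · have hs' : s ∉ Gᶜ := by simpa using hs
      rw [if_neg hs', add_zero]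
      refine E.sum_add_sum_le_one (fun i j => ?_) hdis
      have hinj : Function.Injective fun i => f (s i) := (mem_filter.1 hs).2
      have hi : i = j ↔ f (s i) = f (s j) := ⟨fun h => by rw [h], fun h => hinj h⟩
      rw [← hi]
      exact ⟨fun h => hi.2 (by simpa using congrArg f h), fun h => by rw [h]⟩
    · rw [if_pos (by simpa using hs)]
      exact add_le_add (E.sum_le_one _ _) (E.sum_le_one _ _)
  rw [sum_add_distrib, sum_ite_mem, univ_inter] at h3
  simp only [sum_const, card_univ, Fintype.card_pi, Fintype.card_fin, prod_const, nsmul_eq_mul,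
    mul_one, Nat.cast_pow] at h3
  have hkR : (0 : ℝ) < k := by exact_mod_cast hk0
  have hmR : (0 : ℝ) < m := by exact_mod_cast hm
  have hkn : (0 : ℝ) < (k : ℝ) ^ n := by positivity
  have h4 : (Gᶜ.card : ℝ) * k ≤ n ^ 2 * (((k / m : ℕ) + 1) * k ^ n) := by exact_mod_cast hbad
  have h5 : ((k / m : ℕ) : ℝ) + 1 ≤ 2 * (k / m) := by
    have a : ((k / m : ℕ) : ℝ) ≤ k / m := Nat.cast_div_le
    have b : (1 : ℝ) ≤ k / m := by
      rw [one_le_div hmR]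
      exact_mod_cast (by omega : m ≤ k)
    linarith
  have h6 : 0.8 * (k : ℝ) ^ n * k ≤ n ^ 2 * (2 * (k / m) * k ^ n) := by
    refine le_trans ?_ (h4.trans (by gcongr))
    gcongr
    linarith
  have h7 : 0.8 * ((k : ℝ) ^ n * k) ≤ (n ^ 2 * (2 / m)) * (k ^ n * k) := by
    calc _ = 0.8 * (k : ℝ) ^ n * k := by ring
      _ ≤ _ := h6
      _ = _ := by field_simp
  have h8 := le_of_mul_le_mul_right h7 (by positivity)
  rw [mul_div_assoc', le_div_iff₀ hmR] at h8
  have h9 : (m : ℝ) ≤ 4 * n ^ 2 := by nlinarith [sq_nonneg (n : ℝ)]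
  exact_mod_cast h9

end InvariantEstimator
end DistinctElements

/-! ### Revealed blocks bounded by collisions. -/

namespace DistinctElements

open Finset

variable {k n : ℕ}

theorem card_filter_div_two_eq {j : ℕ} (hj : j < k / 2) :
    (univ.filter fun x : Fin k => (x : ℕ) / 2 = j).card = 2 := by
  have : (univ.filter fun x : Fin k => (x : ℕ) / 2 = j)
      = {⟨2 * j, by omega⟩, ⟨2 * j + 1, by omega⟩} := by
    ext x
    simp only [mem_filter, mem_univ, true_and, mem_insert, mem_singleton, Fin.ext_iff]
    omega
  rw [this, card_pair]
  simp

theorem card_filter_div_two_le (x : Fin k) :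
    (univ.filter fun y : Fin k => (y : ℕ) / 2 = x / 2).card ≤ 2 := by
  refine (card_le_card_of_injOn (t := range 2) (fun y : Fin k => (y : ℕ) % 2) ?_ ?_).trans
    (card_range 2).le
  · intro y _
    simpa using Nat.mod_lt _ two_pos
  · intro y hy y' hy' h
    simp only [coe_filter, mem_univ, true_and, Set.mem_ofPred_eq] at hy hy'
    change (y : ℕ) % 2 = y' % 2 at h
    refine Fin.ext ?_
    omega

theorem card_revealed_le (t B : ℕ) (s : Fin n → Fin k) :
    (revealed t B s).card ≤
      (univ.offDiag.filter fun p : Fin n × Fin n => (s p.1 : ℕ) / 2 = s p.2 / 2).card := by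
  refine (card_le_card ?_).trans (card_image_le (f := fun p : Fin n × Fin n => (s p.1 : ℕ) / 2 / t))
  intro j hj
  obtain ⟨_, i, i', h1, h2, h3⟩ := mem_filter.1 hj
  refine mem_image.2 ⟨(i, i'), ?_, h3⟩
  rw [mem_filter, mem_offDiag]
  exact ⟨⟨mem_univ _, mem_univ _, fun h => h1 (congrArg s h)⟩, h2⟩

/-- With few samples, few blocks are revealed because few pairs of draws fall into the same pair of
balls. -/
theorem InvariantEstimator.mul_le_five_mul_sq [NeZero k] {Δ t B r : ℕ}
    (E : InvariantEstimator k Δ n) (ht : 1 ≤ t) (hB : 2 * t * B ≤ k)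
    (hr : 4 * (2 * Δ / t + 1) ^ 2 ≤ r) (hrB : 2 * r ≤ B) : k * B ≤ 5 * n ^ 2 := by
  have hk : 0 < k := Nat.pos_of_ne_zero (NeZero.ne k)
  have h1 := E.card_unrevealed_le ht hB hr
  set G := univ.filter fun s : Fin n → Fin k => r + (revealed t B s).card ≤ B with hG
  have hcoll := sum_card_collisions_mul_le (fun x : Fin k => (x : ℕ) / 2) (n := n)
    card_filter_div_two_le
  rw [Fintype.card_fin] at hcoll
  have h2 : B * Gᶜ.card ≤ 2 * ∑ s : Fin n → Fin k,
      (univ.offDiag.filter fun p : Fin n × Fin n => (s p.1 : ℕ) / 2 = s p.2 / 2).card := by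
    rw [mul_sum]
    calc B * Gᶜ.card = ∑ s ∈ Gᶜ, B := by rw [sum_const, smul_eq_mul, mul_comm]
      _ ≤ ∑ s ∈ Gᶜ, 2 * (univ.offDiag.filter
            fun p : Fin n × Fin n => (s p.1 : ℕ) / 2 = s p.2 / 2).card := by
          refine sum_le_sum fun s hs => ?_
          -- Outside `G` more than B - r ≥ B/2 blocks are revealed, each by its own colliding pair
          -- of draws.
          have h3 : ¬ (r + (revealed t B s).card ≤ B) := fun h =>
            mem_compl.1 hs (mem_filter.2 ⟨mem_univ _, h⟩)
          have h4 := card_revealed_le t B s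
          omega
      _ ≤ _ := sum_le_sum_of_subset (subset_univ _)
  have h3 : Gᶜ.card + G.card = k ^ n := by
    rw [card_compl_add_card]
    simp
  have hkn : 0 < k ^ n := pow_pos hk n
  have h4 : 4 * k ^ n ≤ 5 * Gᶜ.card := by omega
  refine Nat.le_of_mul_le_mul_left (?_ : 4 * k ^ n * (k * B) ≤ 4 * k ^ n * (5 * n ^ 2))
    (by positivity)
  calc 4 * k ^ n * (k * B) ≤ 5 * Gᶜ.card * (k * B) := Nat.mul_le_mul_right _ h4
    _ = 5 * (B * Gᶜ.card) * k := by ring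
    _ ≤ 5 * (2 * ∑ s : Fin n → Fin k,
      (univ.offDiag.filter fun p : Fin n × Fin n => (s p.1 : ℕ) / 2 = s p.2 / 2).card) * k := by
        gcongr
    _ ≤ 10 * (n ^ 2 * (2 * k ^ n)) := by
        rw [← mul_assoc, mul_assoc]
        exact Nat.mul_le_mul_left _ hcoll
    _ = _ := by ring

/-! ### Undrawn pairs: first and second moments. -/

theorem card_filter_forall_apply {α : Type*} [Fintype α] (P : α → Prop) [DecidablePred P] (n : ℕ) :
    (univ.filter fun s : Fin n → α => ∀ i, P (s i)).card = (univ.filter P).card ^ n := by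
  classical
  have : (univ.filter fun s : Fin n → α => ∀ i, P (s i))
      = Fintype.piFinset fun _ : Fin n => univ.filter P := by
    ext s
    simp
  rw [this, Fintype.card_piFinset_const]

/-- The pairs of which neither ball has been drawn. -/
def undrawn (s : Fin n → Fin k) : Finset ℕ :=
  (range (k / 2)).filter fun j => ∀ i, (s i : ℕ) / 2 ≠ j

theorem card_filter_avoid {j : ℕ} (hj : j < k / 2) :
    ((univ.filter fun s : Fin n → Fin k => ∀ i, (s i : ℕ) / 2 ≠ j).card : ℝ)
      = k ^ n * (1 - 2 / k) ^ n := by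
  have hk : (0 : ℝ) < k := by exact_mod_cast (by omega : 0 < k)
  have h1 := card_filter_add_card_filter_not (s := (univ : Finset (Fin k)))
    (fun x : Fin k => (x : ℕ) / 2 = j)
  rw [card_filter_div_two_eq hj, card_univ, Fintype.card_fin] at h1
  rw [card_filter_forall_apply (fun x : Fin k => (x : ℕ) / 2 ≠ j), Nat.cast_pow, ← mul_pow]
  congr 1
  have h2 : (2 : ℝ) + (univ.filter fun x : Fin k => ¬ (x : ℕ) / 2 = j).card = k := by
    exact_mod_cast h1
  rw [mul_sub, mul_one, mul_div_cancel₀ _ hk.ne']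
  linarith

/-- Avoiding two pairs is negatively correlated: 1 - 4/k ≤ (1 - 2/k)². -/
theorem card_filter_avoid_two_le {j j' : ℕ} (hj : j < k / 2) (hj' : j' < k / 2) (hjj' : j ≠ j') :
    ((univ.filter fun s : Fin n → Fin k =>
      (∀ i, (s i : ℕ) / 2 ≠ j) ∧ ∀ i, (s i : ℕ) / 2 ≠ j').card : ℝ)
      ≤ k ^ n * ((1 - 2 / k) ^ n) ^ 2 := by
  have hk : (0 : ℝ) < k := by exact_mod_cast (by omega : 0 < k)
  have h1 := card_filter_add_card_filter_not (s := (univ : Finset (Fin k)))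
    (fun x : Fin k => (x : ℕ) / 2 = j ∨ (x : ℕ) / 2 = j')
  rw [filter_or, card_union_of_disjoint, card_filter_div_two_eq hj, card_filter_div_two_eq hj',
    card_univ, Fintype.card_fin] at h1
  · simp_rw [← forall_and]
    rw [card_filter_forall_apply (fun x : Fin k => (x : ℕ) / 2 ≠ j ∧ (x : ℕ) / 2 ≠ j'),
      Nat.cast_pow, ← pow_mul, mul_comm n 2, pow_mul, ← mul_pow]
    have h2 : (4 : ℝ) + (univ.filter fun x : Fin k => (x : ℕ) / 2 ≠ j ∧ (x : ℕ) / 2 ≠ j').card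
        = k := by
      simp_rw [not_or] at h1
      exact_mod_cast h1
    refine pow_le_pow_left₀ (Nat.cast_nonneg _) ?_ n
    have h3 : (k : ℝ) * (1 - 2 / k) ^ 2 = k - 4 + 4 / k := by
      field_simp
      ring
    rw [h3]
    have : 0 < 4 / (k : ℝ) := by positivity
    linarith
  · rw [disjoint_filter]
    intro x _ h h'
    exact hjj' (h.symm.trans h')

theorem sum_card_undrawn :
    ∑ s : Fin n → Fin k, ((undrawn s).card : ℝ)
      = k ^ n * ((k / 2 : ℕ) * (1 - 2 / k : ℝ) ^ n) := by
  have h : ∀ s : Fin n → Fin k, ((undrawn s).card : ℝ)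
      = ∑ j ∈ range (k / 2), if ∀ i, (s i : ℕ) / 2 ≠ j then 1 else 0 := by
    intro s
    rw [undrawn, card_filter]
    push_cast
    rfl
  simp_rw [h]
  rw [sum_comm]
  calc _ = ∑ j ∈ range (k / 2), (k : ℝ) ^ n * (1 - 2 / k) ^ n := by
        refine sum_congr rfl fun j hj => ?_
        rw [sum_boole]
        exact card_filter_avoid (mem_range.1 hj)
    _ = _ := by
        rw [sum_const, card_range, nsmul_eq_mul]
        ring

/-- Off-diagonal terms give the squared mean, diagonal ones the mean; so the variance is at most the
mean. -/
theorem sum_card_undrawn_sq_le (hk : 2 ≤ k) :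
    ∑ s : Fin n → Fin k, ((undrawn s).card : ℝ) ^ 2
      ≤ k ^ n * (((k / 2 : ℕ) * (1 - 2 / k : ℝ) ^ n) ^ 2 + (k / 2 : ℕ) * (1 - 2 / k : ℝ) ^ n) := by
  have hp : (0 : ℝ) ≤ 1 - 2 / k := by
    rw [sub_nonneg, div_le_one (by positivity)]
    exact_mod_cast hk
  have h : ∀ s : Fin n → Fin k, ((undrawn s).card : ℝ) ^ 2
      = ∑ j ∈ range (k / 2), ∑ j' ∈ range (k / 2),
        if (∀ i, (s i : ℕ) / 2 ≠ j) ∧ ∀ i, (s i : ℕ) / 2 ≠ j' then 1 else 0 := by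
    intro s
    rw [undrawn, card_filter, sq]
    push_cast
    rw [sum_mul_sum]
    refine sum_congr rfl fun j _ => sum_congr rfl fun j' _ => ?_
    rw [ite_and, ite_mul, one_mul, zero_mul]
  simp_rw [h]
  rw [sum_comm]
  calc _ ≤ ∑ j ∈ range (k / 2), ∑ j' ∈ range (k / 2), (k : ℝ) ^ n *
        (((1 - 2 / k) ^ n) ^ 2 + if j = j' then (1 - 2 / k : ℝ) ^ n else 0) := by
        refine sum_le_sum fun j hj => ?_
        rw [sum_comm]
        refine sum_le_sum fun j' hj' => ?_
        rw [sum_boole]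
        split_ifs with hjj'
        · subst hjj'
          simp_rw [and_self]
          rw [card_filter_avoid (mem_range.1 hj)]
          gcongr
          have : 0 ≤ ((1 - 2 / k : ℝ) ^ n) ^ 2 := by positivity
          linarith
        · rw [add_zero]
          exact card_filter_avoid_two_le (mem_range.1 hj) (mem_range.1 hj') hjj'
    _ = _ := by
        simp_rw [← mul_sum, sum_add_distrib, sum_ite_eq, sum_const, card_range, nsmul_eq_mul]
        rw [sum_ite_mem, inter_self, sum_const, card_range, nsmul_eq_mul]
        ring

/-- If `n` samples suffice, then not too many pairs remain undrawn on average. -/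
theorem InvariantEstimator.mul_pow_lt {Δ : ℕ} (E : InvariantEstimator k Δ n) (hk : 2 ≤ k) :
    ((k / 2 : ℕ) : ℝ) * (1 - 2 / k : ℝ) ^ n < 8 * (2 * Δ + 1) ^ 2 := by
  by_contra! hμ
  have h1 := E.card_unrevealed_le (t := 1) (B := k / 2) (r := 4 * (2 * Δ + 1) ^ 2) le_rfl
    (by omega) (by simp)
  have hsum := sum_card_undrawn (k := k) (n := n)
  have hsq := sum_card_undrawn_sq_le (n := n) hk
  set μ := ((k / 2 : ℕ) : ℝ) * (1 - 2 / k : ℝ) ^ n with hμdef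
  set G := univ.filter fun s : Fin n → Fin k =>
    4 * (2 * Δ + 1) ^ 2 + (revealed 1 (k / 2) s).card ≤ k / 2 with hG
  have hkn : (0 : ℝ) < (k : ℝ) ^ n := by positivity
  have hμ8 : 8 ≤ μ := by
    refine le_trans ?_ hμ
    have : (0 : ℝ) ≤ Δ := Nat.cast_nonneg _
    nlinarith
  have hvar : ∑ s : Fin n → Fin k, (((undrawn s).card : ℝ) - μ) ^ 2 ≤ k ^ n * μ := by
    have e : ∀ s : Fin n → Fin k, (((undrawn s).card : ℝ) - μ) ^ 2
        = ((undrawn s).card : ℝ) ^ 2 - 2 * μ * (undrawn s).card + μ ^ 2 := fun s => by ring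
    simp_rw [e]
    rw [sum_add_distrib, sum_sub_distrib, ← mul_sum, hsum, sum_const, card_univ,
      Fintype.card_pi_const, Fintype.card_fin, nsmul_eq_mul, Nat.cast_pow]
    linarith
  -- Chebyshev: outside `G` at most 4(2Δ+1)² ≤ μ/2 pairs are undrawn, which has probability at most
  -- 4/μ. It is also at least 4/5, so μ ≤ 5, against μ ≥ 8.
  have hbad : (Gᶜ.card : ℝ) * (μ / 2) ^ 2 ≤ k ^ n * μ := by
    refine le_trans ?_ hvar
    rw [← nsmul_eq_mul, ← sum_const]
    refine (sum_le_sum fun s hs => ?_).trans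
      (sum_le_sum_of_subset_of_nonneg (subset_univ Gᶜ) fun _ _ _ => sq_nonneg _)
    have h2 : ¬ (4 * (2 * Δ + 1) ^ 2 + (revealed 1 (k / 2) s).card ≤ k / 2) := fun h =>
      mem_compl.1 hs (mem_filter.2 ⟨mem_univ _, h⟩)
    have h3 : (undrawn s).card + (revealed 1 (k / 2) s).card ≤ k / 2 := by
      rw [← card_union_of_disjoint]
      · refine (card_le_card (union_subset (filter_subset _ _) (filter_subset _ _))).trans ?_
        rw [card_range]
      · rw [disjoint_left]
        intro j hj hj'
        obtain ⟨_, i, _, _, _, h6⟩ := mem_filter.1 hj'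
        rw [Nat.div_one] at h6
        exact (mem_filter.1 hj).2 i h6
    have h4 : ((undrawn s).card : ℝ) ≤ 4 * (2 * Δ + 1) ^ 2 := by
      have : (undrawn s).card ≤ 4 * (2 * Δ + 1) ^ 2 := by omega
      exact_mod_cast this
    have h5 : μ / 2 ≤ μ - (undrawn s).card := by linarith
    calc (μ / 2) ^ 2 ≤ (μ - (undrawn s).card) ^ 2 := pow_le_pow_left₀ (by linarith) h5 2
      _ = _ := by ring
  have h3 : (Gᶜ.card : ℝ) + G.card = k ^ n := by
    have : Gᶜ.card + G.card = k ^ n := by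
      rw [card_compl_add_card]
      simp
    exact_mod_cast this
  have h1' : 5 * (G.card : ℝ) ≤ k ^ n := by exact_mod_cast h1
  have h4 : (4 / 5 : ℝ) * k ^ n ≤ Gᶜ.card := by linarith
  have h5 : (4 / 5 : ℝ) * k ^ n * (μ / 2) ^ 2 ≤ k ^ n * μ := le_trans (by gcongr) hbad
  have h6 : (k : ℝ) ^ n * μ * (μ / 5) ≤ k ^ n * μ * 1 := by linarith
  have h7 := le_of_mul_le_mul_left h6 (by positivity)
  linarith

end DistinctElements

/-! ### Bounds on the sample complexity in the three regimes. -/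

namespace DistinctElements

open Real

/-- Lower bounds on all sufficient sample sizes are lower bounds on the sample complexity. -/
theorem le_sampleComplexity {k Δ : ℕ} [NeZero k] (hΔ : 1 ≤ Δ) {b : ℝ}
    (h : ∀ n, InvariantEstimator k Δ n → b ≤ n) : b ≤ sampleComplexity k Δ := by
  -- Nonemptiness matters here, since `sInf ∅ = 0` would void any lower bound.
  have h1 : Suffices k Δ (sampleComplexity k Δ) := Nat.sInf_mem (exists_suffices k hΔ)
  obtain ⟨E⟩ := h1.exists_invariantEstimator
  exact h _ E

theorem InvariantEstimator.sub_le_four_mul_sq {k Δ n : ℕ} (E : InvariantEstimator k Δ n) :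
    (k : ℝ) - 2 * Δ ≤ 4 * (n : ℝ) ^ 2 := by
  rcases le_or_gt k (2 * Δ) with h | h
  · have h1 : (k : ℝ) ≤ 2 * Δ := by exact_mod_cast h
    nlinarith [sq_nonneg (n : ℝ)]
  · obtain ⟨m, rfl⟩ := Nat.exists_eq_add_of_le h.le
    rw [add_comm] at E
    have h1 : (m : ℝ) ≤ 4 * (n : ℝ) ^ 2 := by exact_mod_cast E.le_four_mul_sq (by omega)
    push_cast
    linarith

theorem sub_div_sqrt_le_sampleComplexity {k Δ : ℕ} [NeZero k] (hΔ : 1 ≤ Δ)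
    (hk : (Δ : ℝ) ≤ (k : ℝ) / 2) :
    1 / 2 * (((k : ℝ) - 2 * Δ) / √k) ≤ sampleComplexity k Δ := by
  refine le_sampleComplexity hΔ fun n E => ?_
  have h1 := E.sub_le_four_mul_sq
  have hk0 : (0 : ℝ) < k := by exact_mod_cast Nat.pos_of_ne_zero (NeZero.ne k)
  have hΔ0 : (0 : ℝ) ≤ Δ := Nat.cast_nonneg _
  have h2 : ((k : ℝ) - 2 * Δ) / √k ≤ 2 * n := by
    refine abs_le_of_sq_le_sq' ?_ (by positivity) |>.2
    rw [div_pow, sq_sqrt hk0.le, div_le_iff₀ hk0]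
    nlinarith
  linarith

theorem exp_neg_two_mul_le {y : ℝ} (h0 : 0 ≤ y) (h : y ≤ 1 / 2) : exp (-(2 * y)) ≤ 1 - y := by
  rw [exp_neg, inv_le_comm₀ (exp_pos _) (by linarith)]
  refine le_trans ?_ (add_one_le_exp (2 * y))
  rw [inv_le_iff_one_le_mul₀ (by linarith)]
  nlinarith

/-- The coupon collector regime. -/
theorem InvariantEstimator.log_lt {k Δ n : ℕ} (E : InvariantEstimator k Δ n) (hΔ : 1 ≤ Δ)
    (hk : 4 ≤ k) : (k : ℝ) / 4 * log (k / (216 * (Δ : ℝ) ^ 2)) < n := by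
  have hkR : (4 : ℝ) ≤ k := by exact_mod_cast hk
  have hΔR : (1 : ℝ) ≤ Δ := by exact_mod_cast hΔ
  have h1 := E.mul_pow_lt (by omega)
  have h2 : (k : ℝ) / 3 ≤ (k / 2 : ℕ) := by
    rw [div_le_iff₀ (by norm_num)]
    exact_mod_cast (by omega : k ≤ k / 2 * 3)
  have h3 : exp (-(4 * n / k)) ≤ (1 - 2 / k : ℝ) ^ n := by
    have : exp (-(4 * n / k)) = exp (-(2 * (2 / (k : ℝ)))) ^ n := by
      rw [← exp_nat_mul]
      congr 1
      ring
    rw [this]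
    refine pow_le_pow_left₀ (exp_pos _).le (exp_neg_two_mul_le (by positivity) ?_) n
    rw [div_le_div_iff₀ (by linarith) (by norm_num)]
    linarith
  -- Since 2Δ + 1 ≤ 3Δ, the right side is at most 72Δ²; the factor 1/3 then yields 216.
  have h4 : (k : ℝ) / 3 * exp (-(4 * n / k)) < 72 * (Δ : ℝ) ^ 2 := by
    calc _ ≤ ((k / 2 : ℕ) : ℝ) * (1 - 2 / k : ℝ) ^ n := by gcongr
      _ < 8 * (2 * Δ + 1) ^ 2 := h1
      _ ≤ _ := by nlinarith
  have h5 : (k : ℝ) / (216 * (Δ : ℝ) ^ 2) < exp (4 * n / k) := by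
    rw [exp_neg, ← div_eq_mul_inv, div_lt_iff₀ (exp_pos _)] at h4
    rw [div_lt_iff₀ (by positivity)]
    linarith
  have h6 := (log_lt_iff_lt_exp (by positivity)).2 h5
  rw [lt_div_iff₀ (by linarith)] at h6
  linarith

/-- The collision regime. -/
theorem InvariantEstimator.pow_three_le {k Δ n : ℕ} [NeZero k] (E : InvariantEstimator k Δ n)
    (hΔ : 1 ≤ Δ) (hk : 512 * Δ ≤ k) (hk' : k ≤ 46656 * Δ ^ 2) :
    (k : ℝ) ^ 3 ≤ 943360 * (Δ : ℝ) ^ 2 * (n : ℝ) ^ 2 := by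
  have hk0 : 0 < k := by omega
  -- The least t with 512Δ² < kt. This gives B ≥ 2r, because t(2Δ/t + 1) ≤ 4Δ and 4tB ≥ k.
  set t := 512 * Δ ^ 2 / k + 1 with ht
  have ht0 : 1 ≤ t := Nat.le_add_left 1 _
  have ht1 : 512 * Δ ^ 2 < k * t := Nat.lt_mul_div_succ _ hk0
  have ht2 : k * t ≤ 47168 * Δ ^ 2 := by
    have := Nat.mul_div_le (512 * Δ ^ 2) k
    rw [ht, mul_add]
    linarith
  have ht3 : t ≤ 2 * Δ := by
    have : 512 * Δ ^ 2 / k ≤ Δ := by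
      refine Nat.div_le_of_le_mul ?_
      nlinarith
    omega
  set B := k / (2 * t) with hB
  have hB1 : k ≤ 4 * t * B := by
    have h1 : k < 2 * t * (B + 1) := Nat.lt_mul_div_succ _ (by positivity)
    have h2 : 1 ≤ B := (Nat.le_div_iff_mul_le (by positivity)).2 (by omega)
    nlinarith
  have hB2 : 2 * t * B ≤ k := Nat.mul_div_le _ _
  have h1 : t * (2 * Δ / t + 1) ≤ 4 * Δ := by
    have := Nat.mul_div_le (2 * Δ) t
    rw [mul_add]
    omega
  have hr : 2 * (4 * (2 * Δ / t + 1) ^ 2) ≤ B := by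
    refine Nat.le_of_mul_le_mul_left (?_ : t ^ 2 * 4 * _ ≤ t ^ 2 * 4 * _) (by positivity)
    calc t ^ 2 * 4 * (2 * (4 * (2 * Δ / t + 1) ^ 2)) = 32 * (t * (2 * Δ / t + 1)) ^ 2 := by ring
      _ ≤ 32 * (4 * Δ) ^ 2 := by gcongr
      _ = 512 * Δ ^ 2 := by ring
      _ ≤ k * t := ht1.le
      _ ≤ 4 * t * B * t := by gcongr
      _ = _ := by ring
  have h2 := E.mul_le_five_mul_sq ht0 hB2 le_rfl hr
  have h3 : k ^ 3 ≤ 943360 * Δ ^ 2 * n ^ 2 := by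
    calc k ^ 3 = k * k * k := by ring
      _ ≤ k * k * (4 * t * B) := by gcongr
      _ = 4 * (k * t) * (k * B) := by ring
      _ ≤ 4 * (47168 * Δ ^ 2) * (5 * n ^ 2) := by gcongr
      _ = _ := by ring
  exact_mod_cast h3

/-- Valid for all Δ ≥ 1, so it serves both regimes in which the target is of order k^(3/2)/Δ. -/
theorem sq_mul_arcosh_le {k Δ : ℕ} (hΔ : 1 ≤ Δ) :
    ((k : ℝ) * arcosh (1 + k / (4 * (Δ : ℝ) ^ 2))) ^ 2 * (2 * (Δ : ℝ) ^ 2) ≤ (k : ℝ) ^ 3 := by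
  have hΔR : (1 : ℝ) ≤ Δ := by exact_mod_cast hΔ
  have hx : 0 ≤ (k : ℝ) / (4 * (Δ : ℝ) ^ 2) := by positivity
  have h1 := arcosh_one_add_le_sqrt hx
  have h2 : arcosh (1 + k / (4 * (Δ : ℝ) ^ 2)) ^ 2 ≤ 2 * (k / (4 * (Δ : ℝ) ^ 2)) := by
    rw [← sq_sqrt (show 0 ≤ 2 * ((k : ℝ) / (4 * (Δ : ℝ) ^ 2)) by positivity)]
    exact pow_le_pow_left₀ (arcosh_nonneg (by linarith)) h1 2
  calc _ = (k : ℝ) ^ 2 * (2 * (Δ : ℝ) ^ 2) * arcosh (1 + k / (4 * (Δ : ℝ) ^ 2)) ^ 2 := by ring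
    _ ≤ (k : ℝ) ^ 2 * (2 * (Δ : ℝ) ^ 2) * (2 * (k / (4 * (Δ : ℝ) ^ 2))) := by gcongr
    _ = (k : ℝ) ^ 3 := by field_simp; ring

theorem mul_arcosh_le_sampleComplexity {k Δ : ℕ} [NeZero k] (hΔ : 1 ≤ Δ)
    (hk : (Δ : ℝ) < (k : ℝ) / 4) :
    1 / 1024 * ((k : ℝ) * arcosh (1 + k / (4 * (Δ : ℝ) ^ 2))) ≤ sampleComplexity k Δ := by
  refine le_sampleComplexity hΔ fun n E => ?_
  have hΔR : (1 : ℝ) ≤ Δ := by exact_mod_cast hΔ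
  have hx : 0 ≤ (k : ℝ) / (4 * (Δ : ℝ) ^ 2) := by positivity
  have hsq := sq_mul_arcosh_le (k := k) hΔ
  set a := (k : ℝ) * arcosh (1 + k / (4 * (Δ : ℝ) ^ 2)) with ha
  have hkR : (4 : ℝ) < k := by linarith
  rw [one_div, inv_mul_le_iff₀ (by norm_num)]
  have hn : (0 : ℝ) ≤ n := Nat.cast_nonneg n
  -- The first case fixes the constant: k ≤ 512Δ and k ≤ 8n² give a² ≤ 4 · 512² n² = (1024n)².
  rcases lt_or_ge k (512 * Δ) with h | h
  · have h1 := E.sub_le_four_mul_sq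
    have h2 : (k : ℝ) ≤ 512 * Δ := by exact_mod_cast h.le
    refine (abs_le_of_sq_le_sq' ?_ (by positivity)).2
    refine le_of_mul_le_mul_right (hsq.trans ?_) (show 0 < 2 * (Δ : ℝ) ^ 2 by positivity)
    have h3 : (k : ℝ) ^ 2 * k ≤ (512 * (Δ : ℝ)) ^ 2 * (8 * (n : ℝ) ^ 2) := by
      gcongr
      linarith
    linarith
  rcases le_or_gt k (46656 * Δ ^ 2) with h' | h'
  · have h1 := E.pow_three_le hΔ h h'
    refine (abs_le_of_sq_le_sq' ?_ (by positivity)).2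
    refine le_of_mul_le_mul_right (hsq.trans (h1.trans ?_)) (show 0 < 2 * (Δ : ℝ) ^ 2 by positivity)
    have : 0 ≤ (Δ : ℝ) ^ 2 * (n : ℝ) ^ 2 := by positivity
    nlinarith
  · have h1 := E.log_lt hΔ (by omega)
    have h2 : (46656 : ℝ) * Δ ^ 2 ≤ k := by exact_mod_cast h'.le
    set y := (k : ℝ) / (Δ : ℝ) ^ 2 with hy
    have hy1 : 46656 ≤ y := by rwa [hy, le_div_iff₀ (by positivity)]
    have hy2 : (k : ℝ) / (216 * (Δ : ℝ) ^ 2) = y / 216 := by rw [hy]; field_simp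
    have hy3 : (k : ℝ) / (4 * (Δ : ℝ) ^ 2) = y / 4 := by rw [hy]; field_simp
    -- As 46656 = 216², y/216 ≥ 216, so the fourth power of y/216 exceeds 1 + y.
    have h3 : arcosh (1 + y / 4) ≤ 8 * log (y / 216) := by
      refine (arcosh_one_add_le_log (by linarith)).trans ?_
      have e : 8 * log (y / 216) = 2 * log ((y / 216) ^ 4) := by
        rw [log_pow]
        push_cast
        ring
      rw [e]
      gcongr
      have h4 : 216 ≤ y / 216 := by linarith
      have h5 : (216 : ℝ) ^ 3 * (y / 216) ≤ (y / 216) ^ 3 * (y / 216) := by gcongr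
      linarith
    rw [hy2] at h1
    have h4 : a ≤ k * (8 * log (y / 216)) := by
      rw [ha, hy3]
      gcongr
    linarith

/-! ### Order of magnitude of the arcosh bound. -/

theorem arcosh_order {k Δ : ℕ} (hΔ : 1 ≤ Δ) :
    ((Δ : ℝ) ≤ √k →
      1 / 4 * ((k : ℝ) * log (1 + k / (Δ : ℝ) ^ 2)) ≤ k * arcosh (1 + k / (4 * (Δ : ℝ) ^ 2)) ∧
      k * arcosh (1 + k / (4 * (Δ : ℝ) ^ 2)) ≤ 2 * ((k : ℝ) * log (1 + k / (Δ : ℝ) ^ 2))) ∧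
    (√k ≤ (Δ : ℝ) →
      1 / 4 * ((k : ℝ) ^ (3 / 2 : ℝ) / Δ) ≤ k * arcosh (1 + k / (4 * (Δ : ℝ) ^ 2)) ∧
      k * arcosh (1 + k / (4 * (Δ : ℝ) ^ 2)) ≤ 2 * ((k : ℝ) ^ (3 / 2 : ℝ) / Δ)) := by
  have hΔR : (0 : ℝ) < Δ := by exact_mod_cast hΔ
  have hk : (0 : ℝ) ≤ k := Nat.cast_nonneg k
  set x := (k : ℝ) / (4 * (Δ : ℝ) ^ 2) with hx
  have hx0 : 0 ≤ x := by positivity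
  have h4x : (k : ℝ) / (Δ : ℝ) ^ 2 = 4 * x := by rw [hx]; field_simp
  rw [h4x]
  refine ⟨fun h => ?_, fun h => ?_⟩
  · have h1 : (Δ : ℝ) ^ 2 ≤ k := (le_sqrt hΔR.le hk).1 h
    have h2 : 1 / 4 ≤ x := by
      rw [hx, div_le_div_iff₀ (by norm_num) (by positivity)]
      linarith
    have hlog : 0 ≤ log (1 + 4 * x) := log_nonneg (by linarith)
    have h3 := log_le_arcosh_one_add hx0
    have h4 := arcosh_one_add_le_log h2
    constructor
    · rw [mul_left_comm]
      exact mul_le_mul_of_nonneg_left (by linarith) hk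
    · rw [mul_left_comm]
      exact mul_le_mul_of_nonneg_left h4 hk
  · have h1 : (k : ℝ) ≤ (Δ : ℝ) ^ 2 := (sqrt_le_left hΔR.le).1 h
    have h2 : x ≤ 1 / 4 := by
      rw [hx, div_le_div_iff₀ (by positivity) (by norm_num)]
      linarith
    have hpow : (k : ℝ) ^ (3 / 2 : ℝ) / Δ = k * (√k / Δ) := by
      rcases hk.eq_or_lt with h0 | h0
      · rw [← h0, zero_rpow (by norm_num)]
        simp
      · rw [show (3 / 2 : ℝ) = 1 + 1 / 2 by norm_num, rpow_add h0, rpow_one, ← sqrt_eq_rpow,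
          mul_div_assoc]
    have hq : √k / Δ = √(4 * x) := by
      rw [← h4x, sqrt_div hk, sqrt_sq hΔR.le]
    have h3 := sqrt_le_arcosh_one_add hx0 (by linarith)
    have h4 := arcosh_one_add_le_sqrt hx0
    have h5 : √(2 * x) ≤ √(4 * x) := sqrt_le_sqrt (by linarith)
    have h6 : √(4 * x) ≤ 2 * √(2 * x) := by
      rw [sqrt_le_left (by positivity), mul_pow, sq_sqrt (by positivity)]
      linarith
    have h7 := sqrt_nonneg (4 * x)
    rw [hpow, hq]
    constructor
    · rw [mul_left_comm]
      exact mul_le_mul_of_nonneg_left (by linarith) hk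
    · rw [mul_left_comm]
      exact mul_le_mul_of_nonneg_left (by linarith) hk

end DistinctElements

theorem mainTheorem3 :
    (∃ c : ℝ, 0 < c ∧ ∀ (k Δ : ℕ) [NeZero k], 1 ≤ Δ → (Δ : ℝ) ≤ (k : ℝ) / 2 →
      c * (((k : ℝ) - 2 * (Δ : ℝ)) / √(k : ℝ)) ≤ (DistinctElements.sampleComplexity k Δ : ℝ)) ∧
    (∃ c : ℝ, 0 < c ∧ ∀ (k Δ : ℕ) [NeZero k], 1 ≤ Δ → (Δ : ℝ) < (k : ℝ) / 4 →
      c * ((k : ℝ) * Real.arcosh (1 + (k : ℝ) / (4 * (Δ : ℝ) ^ 2)))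
        ≤ (DistinctElements.sampleComplexity k Δ : ℝ)) ∧
    (∃ c₁ c₂ : ℝ, 0 < c₁ ∧ 0 < c₂ ∧ ∀ k Δ : ℕ, 1 ≤ Δ → (Δ : ℝ) < (k : ℝ) / 4 →
      ((Δ : ℝ) ≤ √(k : ℝ) →
        c₁ * ((k : ℝ) * Real.log (1 + (k : ℝ) / (Δ : ℝ) ^ 2))
            ≤ (k : ℝ) * Real.arcosh (1 + (k : ℝ) / (4 * (Δ : ℝ) ^ 2)) ∧
        (k : ℝ) * Real.arcosh (1 + (k : ℝ) / (4 * (Δ : ℝ) ^ 2))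
            ≤ c₂ * ((k : ℝ) * Real.log (1 + (k : ℝ) / (Δ : ℝ) ^ 2))) ∧
      (√(k : ℝ) ≤ (Δ : ℝ) →
        c₁ * ((k : ℝ) ^ (3 / 2 : ℝ) / (Δ : ℝ))
            ≤ (k : ℝ) * Real.arcosh (1 + (k : ℝ) / (4 * (Δ : ℝ) ^ 2)) ∧
        (k : ℝ) * Real.arcosh (1 + (k : ℝ) / (4 * (Δ : ℝ) ^ 2))
            ≤ c₂ * ((k : ℝ) ^ (3 / 2 : ℝ) / (Δ : ℝ)))) := by
  exact ⟨⟨1 / 2, by norm_num, fun k Δ _ hΔ hk =>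
      DistinctElements.sub_div_sqrt_le_sampleComplexity hΔ hk⟩,
    ⟨1 / 1024, by norm_num, fun k Δ _ hΔ hk =>
      DistinctElements.mul_arcosh_le_sampleComplexity hΔ hk⟩,
    ⟨1 / 4, 2, by norm_num, by norm_num, fun k Δ hΔ _ => DistinctElements.arcosh_order hΔ⟩⟩
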